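/- Let $h\ge 1$, $c_0,c_1,\dots,c_h>0$ and $\nu_0,\nu_1,\dots,\nu_h\in(0,1)$. On a probability space let $S_1,\dots,S_h$ be real-valued Lévy processes and let $L_0^{\nu_0},L_1^{\nu_1},\dots,L_h^{\nu_h}$ be inverse stable subordinators of parameters $\nu_0,\dots,\nu_h$, that is, $L_j^{\nu_j}(t)=\inf\{s\ge 0: D_j(s)>t\}$ where $D_j$ is a stable subordinator of order $\nu_j$, i.e. a nondecreasing Lévy process with $\mathbb{E}[e^{\theta D_j(t)}]=e^{-t(-\theta)^{\nu_j}}$ for all $\theta\le 0$, $t\ge 0$. Assume that the $2h+1$ processes $S_1,\dots,S_h,L_0^{\nu_0},\dots,L_h^{\nu_h}$ are independent, and that each $S_i$ is light-tailed, i.e. $\kappa_{S_i}(\theta):=\log\mathbb{E}[e^{\theta S_i(1)}]$ is finite for all $\theta$ in a neighbourhood of $0$. Put $m=(m_1,\dots,m_h):=(\kappa_{S_1}'(0),\dots,\kappa_{S_h}'(0))$ and, for $\nu\in(0,1)$, $\alpha_m(\nu):=1-\nu/2$ if $m=0$ and $\alpha_m(\nu):=1-\nu$ if $m\ne 0$;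 write $x\vee y$ for the maximum of $x$ and $y$. Consider, for $t>0$, the random vector $$X(t):=\left(t^{\alpha_m(\nu_0\vee\nu_i)}\,\frac{S_i\big(c_iL_i^{\nu_i}(t)+c_0L_0^{\nu_0}(t)\big)}{t}\right)_{i\in\{1,\dots,h\}}.$$ 1. If $m=0$, then, as $t\to\infty$, $X(t)$ converges weakly (in distribution) to $$\left(\sqrt{c_iL_i^{\nu_i}(1)\,\kappa_{S_i}''(0)\,1_{\{\nu_0\le\nu_i\}}}\;Z_i+\sqrt{c_0L_0^{\nu_0}(1)\,\kappa_{S_i}''(0)\,1_{\{\nu_i\le\nu_0\}}}\;\widehat Z_i\right)_{i\in\{1,\dots,h\}},$$ where $Z_1,\dots,Z_h,\widehat Z_1,\dots,\widehat Z_h$ are independent standard normal random variables, independent of all the other random variables. 2. If $m\neq 0$, then, as $t\to\infty$, $X(t)$ converges weakly to $$\left(c_im_i1_{\{\nu_0\le\nu_i\}}L_i^{\nu_i}(1)+c_0m_i1_{\{\nu_i\le\nu_0\}}L_0^{\nu_0}(1)\right)_{i\in\{1,\dots,h\}}.$$ -/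

import Mathlib

open MeasureTheory ProbabilityTheory Filter Topology
open scoped NNReal

/-- A real-valued Lévy process `(X t)_{t ≥ 0}` on `(Ω, P)`: it starts at `0` almost surely, has
independent and stationary increments, and almost all of its paths are right-continuous with left
limits. -/
structure IsLevyProcess {Ω : Type*} [MeasurableSpace Ω] (X : ℝ≥0 → Ω → ℝ) (P : Measure Ω) :
    Prop where
  measurable : ∀ t, Measurable (X t)
  zero : ∀ᵐ ω ∂P, X 0 ω = 0
  indepIncrements : HasIndepIncrements X P
  stationaryIncrements : ∀ s t : ℝ≥0,
    IdentDistrib (fun ω ↦ X (s + t) ω - X s ω) (X t) P P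
  cadlag : ∀ᵐ ω ∂P, ∀ t : ℝ≥0,
    ContinuousWithinAt (fun s ↦ X s ω) (Set.Ici t) t ∧
      ∃ l : ℝ, Tendsto (fun s ↦ X s ω) (𝓝[<] t) (𝓝 l)

/-- A stable subordinator of order `ν`: a nondecreasing Lévy process `D` with
`𝔼[exp (θ D(t))] = exp (-t (-θ)^ν)` for all `θ ≤ 0` and `t ≥ 0`. -/
structure IsStableSubordinator {Ω : Type*} [MeasurableSpace Ω] (ν : ℝ) (D : ℝ≥0 → Ω → ℝ)
    (P : Measure Ω) : Prop where
  isLevyProcess : IsLevyProcess D P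
  monotone : ∀ᵐ ω ∂P, Monotone fun t ↦ D t ω
  mgf_eq : ∀ (t : ℝ≥0) (θ : ℝ), θ ≤ 0 → mgf (D t) P θ = Real.exp (-(t : ℝ) * (-θ) ^ ν)

/-- An inverse stable subordinator of parameter `ν`: the process
`L(t) = inf {s ≥ 0 : D(s) > t}` for a stable subordinator `D` of order `ν`.
(The set is almost surely nonempty for every `t`.) -/
structure IsInverseStableSubordinator {Ω : Type*} [MeasurableSpace Ω] (ν : ℝ)
    (L : ℝ≥0 → Ω → ℝ≥0) (P : Measure Ω) : Prop where
  measurable : ∀ t, Measurable (L t)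
  exists_subordinator : ∃ D : ℝ≥0 → Ω → ℝ, IsStableSubordinator ν D P ∧
    ∀ᵐ ω ∂P, ∀ t : ℝ≥0, L t ω = sInf {s : ℝ≥0 | (t : ℝ) < D s ω}

/-- The cumulant generating function `κ(θ) = log 𝔼[exp (θ X(1))]` of a process. -/
noncomputable def kappa {Ω : Type*} [MeasurableSpace Ω] (X : ℝ≥0 → Ω → ℝ) (P : Measure Ω) :
    ℝ → ℝ :=
  cgf (X 1) P

/-- The vector `m = (κ₁'(0), …, κ_h'(0))`. -/
noncomputable def meanVector {Ω : Type*} [MeasurableSpace Ω] {h : ℕ}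
    (S : Fin h → ℝ≥0 → Ω → ℝ) (P : Measure Ω) : Fin h → ℝ :=
  fun i ↦ deriv (kappa (S i) P) 0

open Classical in
/-- The exponent `α_m(ν)`, equal to `1 - ν / 2` if `m = 0` and to `1 - ν` if `m ≠ 0`. -/
noncomputable def scalingExponent {h : ℕ} (m : Fin h → ℝ) (ν : ℝ) : ℝ :=
  if m = 0 then 1 - ν / 2 else 1 - ν

/-- The rescaled time-changed vector at time `t`, with `i`-th component
`t ^ α_m(ν₀ ∨ ν_i) * S_i(c_i L_i(t) + c₀ L₀(t)) / t`. -/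
noncomputable def scaledProcess {Ω : Type*} [MeasurableSpace Ω] {h : ℕ} (P : Measure Ω)
    (S : Fin h → ℝ≥0 → Ω → ℝ) (L : Fin (h + 1) → ℝ≥0 → Ω → ℝ≥0)
    (c : Fin (h + 1) → ℝ≥0) (ν : Fin (h + 1) → ℝ) (t : ℝ≥0) (ω : Ω) : Fin h → ℝ :=
  fun i ↦ (t : ℝ) ^ scalingExponent (meanVector S P) (max (ν 0) (ν i.succ)) *
    (S i (c i.succ * L i.succ t ω + c 0 * L 0 t ω) ω / (t : ℝ))

/-! Self-similarity makes the vector of clocks at time `t` equal in law to `(t ^ ν_j * L_j 1)_j`.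
After this replacement, conditioning on the independent clocks turns the characteristic function of
`X(t)` into the expectation of a product over `i`: the characteristic function of `S_i` at a
deterministic time of order at most `t ^ N`, with `N = max ν_0 ν_i`, evaluated at `u_i * t ^ (-N /
2)` if `m = 0` and at `u_i * t ^ (-N)` otherwise (`integral_cexp_scaledProcess`).

For fixed clock values this is the ordinary central limit theorem or law of large numbers for `S_i`,
obtained from the second- or first-order expansion of one characteristic function at `0`
(`tendsto_charFun_exp_variance`, `tendsto_charFun_exp_mean`). Only the clock with the larger
exponent survives in the rescaled time, and both survive in a tie; hence the indicators.

All integrands are bounded by `1`, so dominated convergence gives the limit of the characteristic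
functions, and Lévy's continuity theorem concludes. For `m = 0` the limit is a Gaussian mixture:
given the clocks the variance in coordinate `i` is a sum of two terms, which the independent `Z_i`
and `Ẑ_i` realise separately.

Self-similarity itself comes from the scaling of the subordinator, whose law is determined by its
Laplace transform on the negative half-line. -/

/-! ### Characteristic functions of Lévy processes: long times, small arguments. -/

section LevyCharFun

variable {Ω : Type*} [MeasurableSpace Ω] {P : Measure Ω} {X : ℝ≥0 → Ω → ℝ}

theorem charFun_map_eq_integral {Y : Ω → ℝ} (hY : AEMeasurable Y P) (u : ℝ) :
    charFun (P.map Y) u = ∫ ω, Complex.exp (u * Y ω * Complex.I) ∂P := by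
  rw [charFun_apply_real, integral_map hY (by fun_prop)]

theorem norm_cexp_ofReal_mul_ofReal_mul_I (u x : ℝ) : ‖Complex.exp (u * x * Complex.I)‖ = 1 := by
  rw [← Complex.ofReal_mul, Complex.norm_exp_ofReal_mul_I]

theorem IsLevyProcess.charFun_add [IsProbabilityMeasure P] (hX : IsLevyProcess X P) (s t : ℝ≥0)
    (u : ℝ) :
    charFun (P.map (X (s + t))) u = charFun (P.map (X s)) u * charFun (P.map (X t)) u := by
  have hind := hX.indepIncrements.indepFun_eval_sub (zero_le (a := s))
    (le_add_of_nonneg_right (zero_le (a := t)) : s ≤ s + t) hX.zero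
  have h := hind.charFun_map_add_eq_mul (hX.measurable s).aemeasurable
    ((hX.measurable (s + t)).sub (hX.measurable s)).aemeasurable
  have h2 : X s + (X (s + t) - X s) = X (s + t) := by abel
  rw [h2] at h
  rw [h, Pi.mul_apply, ← (hX.stationaryIncrements s t).map_eq]
  rfl

theorem IsLevyProcess.charFun_nat_add [IsProbabilityMeasure P] (hX : IsLevyProcess X P) (n : ℕ)
    (r : ℝ≥0) (u : ℝ) :
    charFun (P.map (X (n + r))) u = charFun (P.map (X 1)) u ^ n * charFun (P.map (X r)) u := by
  induction n with
  | zero => simp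
  | succ k ih =>
    rw [Nat.cast_succ, add_comm (k : ℝ≥0) 1, add_assoc, hX.charFun_add, ih, pow_succ']
    ring

theorem IsLevyProcess.tendsto_charFun_of_tendsto_right [IsProbabilityMeasure P]
    (hX : IsLevyProcess X P) (u : ℝ) {s : ℕ → ℝ≥0} {t : ℝ≥0} (hs : Tendsto s atTop (𝓝 t))
    (hst : ∀ n, t ≤ s n) :
    Tendsto (fun n ↦ charFun (P.map (X (s n))) u) atTop (𝓝 (charFun (P.map (X t)) u)) := by
  simp_rw [charFun_map_eq_integral (hX.measurable _).aemeasurable]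
  refine tendsto_integral_of_dominated_convergence (fun _ ↦ 1) (fun n ↦ ?_)
    (integrable_const _) (fun n ↦ ?_) ?_
  · have := hX.measurable (s n)
    fun_prop
  · exact Eventually.of_forall fun ω ↦ (norm_cexp_ofReal_mul_ofReal_mul_I _ _).le
  · filter_upwards [hX.cadlag] with ω hω
    have h1 : Tendsto (fun n ↦ X (s n) ω) atTop (𝓝 (X t ω)) :=
      ((hω t).1.tendsto).comp (tendsto_nhdsWithin_iff.2 ⟨hs, Eventually.of_forall hst⟩)
    have h2 : Continuous fun x : ℝ ↦ Complex.exp (u * x * Complex.I) := by fun_prop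
    exact (h2.tendsto _).comp h1

/-- One-sided limits bound the path near each point, and compactness makes the bound uniform. -/
theorem exists_forall_abs_le_of_cadlag {f : ℝ≥0 → ℝ}
    (hf : ∀ t : ℝ≥0, ContinuousWithinAt f (Set.Ici t) t ∧ ∃ l : ℝ, Tendsto f (𝓝[<] t) (𝓝 l))
    (a b : ℝ≥0) : ∃ C, ∀ s ∈ Set.Icc a b, |f s| ≤ C := by
  have key : ∀ t : ℝ≥0, ∃ C, ∀ᶠ s in 𝓝 t, |f s| ≤ C := by
    intro t
    obtain ⟨h1, l, h2⟩ := hf t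
    refine ⟨max (|f t| + 1) (|l| + 1), ?_⟩
    have e1 : ∀ᶠ s in 𝓝[≥] t, |f s| < |f t| + 1 :=
      (h1.abs).eventually_lt_const (by linarith)
    have e2 : ∀ᶠ s in 𝓝[<] t, |f s| < |l| + 1 :=
      (h2.abs).eventually_lt_const (by linarith)
    rw [← nhdsLT_sup_nhdsGE t, eventually_sup]
    exact ⟨e2.mono fun s hs ↦ le_max_of_le_right hs.le, e1.mono fun s hs ↦ le_max_of_le_left hs.le⟩
  refine isCompact_Icc.induction_on (p := fun A ↦ ∃ C, ∀ s ∈ A, |f s| ≤ C) ⟨0, by simp⟩ ?_ ?_ ?_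
  · rintro A B hAB ⟨C, hC⟩
    exact ⟨C, fun s hs ↦ hC s (hAB hs)⟩
  · rintro A B ⟨C, hC⟩ ⟨D, hD⟩
    refine ⟨max C D, fun s hs ↦ ?_⟩
    rcases hs with hs | hs
    · exact le_max_of_le_left (hC s hs)
    · exact le_max_of_le_right (hD s hs)
  · intro t _
    obtain ⟨C, hC⟩ := key t
    exact ⟨_, mem_nhdsWithin_of_mem_nhds hC, C, fun s hs ↦ hs⟩

/-- Almost every path is bounded on `[0, 1]`, so the times `s n` need not converge. This disposes of
the fractional part of a large time. -/
theorem IsLevyProcess.tendsto_charFun_one [IsProbabilityMeasure P] (hX : IsLevyProcess X P)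
    {ι : Type*} {l : Filter ι} [l.IsCountablyGenerated] {u : ι → ℝ} {s : ι → ℝ≥0}
    (hu : Tendsto u l (𝓝 0)) (hs : ∀ n, s n ≤ 1) :
    Tendsto (fun n ↦ charFun (P.map (X (s n))) (u n)) l (𝓝 1) := by
  simp_rw [charFun_map_eq_integral (hX.measurable _).aemeasurable]
  have h1 : (1 : ℂ) = ∫ _ω : Ω, (1 : ℂ) ∂P := by simp
  rw [h1]
  refine tendsto_integral_filter_of_dominated_convergence (fun _ ↦ 1)
    (Eventually.of_forall fun n ↦ ?_) (Eventually.of_forall fun n ↦ ?_) (integrable_const _) ?_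
  · have := hX.measurable (s n)
    fun_prop
  · exact Eventually.of_forall fun ω ↦ (norm_cexp_ofReal_mul_ofReal_mul_I _ _).le
  · filter_upwards [hX.cadlag] with ω hω
    obtain ⟨C, hC⟩ := exists_forall_abs_le_of_cadlag hω 0 1
    have h2 : Tendsto (fun n ↦ u n * X (s n) ω) l (𝓝 0) := by
      refine hu.zero_mul_isBoundedUnder_le (isBoundedUnder_of ⟨C, fun n ↦ ?_⟩)
      exact hC _ ⟨zero_le, hs n⟩
    have h3 : Continuous fun x : ℝ ↦ Complex.exp (x * Complex.I) := by fun_prop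
    have h4 := (h3.tendsto 0).comp h2
    simpa [Function.comp_def] using h4

theorem norm_pow_sub_pow_le_mul {a b : ℂ} (ha : ‖a‖ ≤ 1) (hb : ‖b‖ ≤ 1) (n : ℕ) :
    ‖a ^ n - b ^ n‖ ≤ n * ‖a - b‖ := by
  induction n with
  | zero => simp
  | succ k ih =>
    have e : a ^ (k + 1) - b ^ (k + 1) = a ^ k * (a - b) + (a ^ k - b ^ k) * b := by ring
    have h1 : ‖a ^ k‖ ≤ 1 := by rw [norm_pow]; exact pow_le_one₀ (norm_nonneg _) ha
    rw [e]
    refine (norm_add_le _ _).trans ?_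
    rw [norm_mul, norm_mul]
    have h2 := mul_le_mul_of_nonneg_right h1 (norm_nonneg (a - b))
    have h3 := mul_le_mul_of_nonneg_left hb (norm_nonneg (a ^ k - b ^ k))
    push_cast
    linarith

/-- If the characteristic function of `X 1` is approximated near `0` by `g` up to `o(r)`, then the
characteristic function of `X τ` at `u → 0` has the same limit as `g u ^ ⌊τ⌋` as long as
`τ * r u` converges. -/
theorem IsLevyProcess.tendsto_charFun_of_isLittleO [IsProbabilityMeasure P]
    (hX : IsLevyProcess X P) {ι : Type*} {l : Filter ι} [l.IsCountablyGenerated] {u : ι → ℝ}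
    {τ : ι → ℝ≥0} (hu : Tendsto u l (𝓝 0)) {g : ℝ → ℂ} {r : ℝ → ℝ} (hg : ∀ x, ‖g x‖ ≤ 1)
    (hgr : (fun x ↦ charFun (P.map (X 1)) x - g x) =o[𝓝 0] r) {v : ℝ}
    (hv : Tendsto (fun n ↦ (τ n : ℝ) * r (u n)) l (𝓝 v)) {z : ℂ}
    (hz : Tendsto (fun n ↦ g (u n) ^ ⌊τ n⌋₊) l (𝓝 z)) :
    Tendsto (fun n ↦ charFun (P.map (X (τ n))) (u n)) l (𝓝 z) := by
  have : IsProbabilityMeasure (P.map (X 1)) :=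
    Measure.isProbabilityMeasure_map (hX.measurable 1).aemeasurable
  -- Splitting the time into integer and fractional parts leaves a genuine power, so no
  -- characteristic exponent or complex logarithm is needed.
  have hdec : ∀ n, charFun (P.map (X (τ n))) (u n) =
      charFun (P.map (X 1)) (u n) ^ ⌊τ n⌋₊ * charFun (P.map (X (τ n - ⌊τ n⌋₊))) (u n) := by
    intro n
    rw [← hX.charFun_nat_add, add_tsub_cancel_of_le (Nat.floor_le zero_le)]
  simp_rw [hdec]
  have hfrac : Tendsto (fun n ↦ charFun (P.map (X (τ n - ⌊τ n⌋₊))) (u n)) l (𝓝 1) := by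
    refine hX.tendsto_charFun_one hu fun n ↦ ?_
    rw [tsub_le_iff_left]
    exact (Nat.lt_floor_add_one (τ n)).le
  have hpow : Tendsto (fun n ↦ charFun (P.map (X 1)) (u n) ^ ⌊τ n⌋₊ - g (u n) ^ ⌊τ n⌋₊) l
      (𝓝 0) := by
    have ho : (fun n ↦ charFun (P.map (X 1)) (u n) - g (u n)) =o[l] fun n ↦ r (u n) :=
      hgr.comp_tendsto hu
    have ho2 : (fun n ↦ ((τ n : ℝ) : ℂ) * (charFun (P.map (X 1)) (u n) - g (u n))) =o[l]
        fun n ↦ (τ n : ℝ) * r (u n) := by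
      refine Asymptotics.IsBigO.mul_isLittleO ?_ ho
      exact Asymptotics.IsBigO.of_norm_le fun n ↦ by simp
    have ho3 := ho2.trans_isBigO (hv.isBigO_one ℝ)
    -- Replacing the base of the power costs at most `⌊τ⌋` times an `o(r u)` error, which vanishes
    -- because `τ * r u` converges.
    rw [Asymptotics.isLittleO_one_iff] at ho3
    refine squeeze_zero_norm (fun n ↦ ?_) (tendsto_zero_iff_norm_tendsto_zero.1 ho3)
    refine (norm_pow_sub_pow_le_mul (norm_charFun_le_one _) (hg _) _).trans ?_
    rw [norm_mul]
    gcongr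
    simp only [Complex.norm_real, NNReal.norm_eq]
    exact_mod_cast Nat.floor_le (zero_le (a := τ n))
  simpa using (hpow.add hz).mul hfrac

theorem tendsto_floor_mul_of_tendsto_mul {ι : Type*} {l : Filter ι} {τ : ι → ℝ≥0} {r : ι → ℝ}
    (hr : Tendsto r l (𝓝 0)) {v : ℝ} (hv : Tendsto (fun n ↦ (τ n : ℝ) * r n) l (𝓝 v)) :
    Tendsto (fun n ↦ (⌊τ n⌋₊ : ℝ) * r n) l (𝓝 v) := by
  have h : Tendsto (fun n ↦ ((⌊τ n⌋₊ : ℝ) - τ n) * r n) l (𝓝 0) := by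
    rw [tendsto_zero_iff_norm_tendsto_zero]
    refine squeeze_zero (fun _ ↦ norm_nonneg _) (fun n ↦ ?_) (tendsto_zero_iff_norm_tendsto_zero.1 hr)
    rw [norm_mul]
    refine mul_le_of_le_one_left (norm_nonneg _) ?_
    have h1 : ((⌊τ n⌋₊ : ℝ≥0) : ℝ) ≤ τ n := by exact_mod_cast Nat.floor_le (zero_le (a := τ n))
    have h2 : (τ n : ℝ) < ((⌊τ n⌋₊ : ℝ≥0) : ℝ) + 1 := by exact_mod_cast Nat.lt_floor_add_one (τ n)
    simp only [NNReal.coe_natCast] at h1 h2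
    rw [Real.norm_eq_abs, abs_le]
    constructor <;> linarith
  simpa [← add_mul] using h.add hv

theorem memLp_id_map_of_zero_mem_interior [IsProbabilityMeasure P] {Y : Ω → ℝ} (hY : Measurable Y)
    (h0 : (0 : ℝ) ∈ interior (integrableExpSet Y P)) (p : ℝ≥0) : MemLp id p (P.map Y) := by
  rw [memLp_map_measure_iff (by fun_prop) hY.aemeasurable]
  exact memLp_of_mem_interior_integrableExpSet h0 p

theorem IsLevyProcess.tendsto_charFun_exp_mean [IsProbabilityMeasure P] (hX : IsLevyProcess X P)
    (h0 : (0 : ℝ) ∈ interior (integrableExpSet (X 1) P)) {ι : Type*} {l : Filter ι}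
    [l.IsCountablyGenerated] {u : ι → ℝ} {τ : ι → ℝ≥0} (hu : Tendsto u l (𝓝 0)) {v : ℝ}
    (hv : Tendsto (fun n ↦ (τ n : ℝ) * u n) l (𝓝 v)) :
    Tendsto (fun n ↦ charFun (P.map (X (τ n))) (u n)) l
      (𝓝 (Complex.exp ((deriv (kappa X P) 0 * v : ℝ) * Complex.I))) := by
  have : IsProbabilityMeasure (P.map (X 1)) :=
    Measure.isProbabilityMeasure_map (hX.measurable 1).aemeasurable
  set m := deriv (kappa X P) 0 with hm
  have hmP : m = ∫ ω, X 1 ω ∂P := by rw [hm, kappa, deriv_cgf_zero h0]; simp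
  refine hX.tendsto_charFun_of_isLittleO hu
    -- An exponential rather than the Taylor polynomial: it keeps norm at most `1` everywhere and
    -- its powers are explicit.
    (g := fun x ↦ Complex.exp ((m * x : ℝ) * Complex.I)) (r := fun x ↦ x)
    (fun x ↦ (Complex.norm_exp_ofReal_mul_I _).le) ?_ hv ?_
  · have hmem : MemLp id (1 : ℕ) (P.map (X 1)) := by
      simpa using memLp_id_map_of_zero_mem_interior (hX.measurable 1) h0 1
    have hd : HasDerivAt (charFun (P.map (X 1))) (Complex.I * m) 0 := by
      have h1 := ((contDiff_charFun hmem).differentiable (by simp)).differentiableAt (x := (0 : ℝ))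
        |>.hasDerivAt
      have h2 := iteratedDeriv_charFun_zero hmem
      rw [iteratedDeriv_one] at h2
      have h3 : (∫ x, x ^ 1 ∂(P.map (X 1))) = m := by
        rw [integral_map (hX.measurable 1).aemeasurable (by fun_prop), hmP]
        simp
      rwa [h2, pow_one, h3] at h1
    have hd2 : HasDerivAt (fun x : ℝ ↦ Complex.exp ((m * x : ℝ) * Complex.I)) (Complex.I * m) 0 := by
      have h1 : HasDerivAt (fun x : ℝ ↦ ((m * x : ℝ) : ℂ) * Complex.I) (m * Complex.I) 0 := by
        have := ((hasDerivAt_id (0 : ℝ)).const_mul m).ofReal_comp.mul_const Complex.I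
        simpa using this
      have := h1.cexp
      simpa [mul_comm] using this
    have := (hd.sub hd2).isLittleO
    simpa using this
  · have h1 := tendsto_floor_mul_of_tendsto_mul hu hv
    have h2 : Continuous fun x : ℝ ↦ Complex.exp ((m * x : ℝ) * Complex.I) := by fun_prop
    refine ((h2.tendsto v).comp h1).congr fun n ↦ ?_
    rw [← Complex.exp_nat_mul]
    simp only [Function.comp]
    congr 1
    push_cast
    ring

theorem iteratedDeriv_two_kappa_eq [IsProbabilityMeasure P]
    (h0 : (0 : ℝ) ∈ interior (integrableExpSet (X 1) P)) (hm : deriv (kappa X P) 0 = 0) :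
    iteratedDeriv 2 (kappa X P) 0 = ∫ ω, X 1 ω ^ 2 ∂P := by
  rw [kappa] at hm ⊢
  rw [iteratedDeriv_two_cgf h0, hm]
  simp

theorem IsLevyProcess.tendsto_charFun_exp_variance [IsProbabilityMeasure P]
    (hX : IsLevyProcess X P) (h0 : (0 : ℝ) ∈ interior (integrableExpSet (X 1) P))
    (hm : deriv (kappa X P) 0 = 0) {ι : Type*} {l : Filter ι}
    [l.IsCountablyGenerated] {u : ι → ℝ} {τ : ι → ℝ≥0} (hu : Tendsto u l (𝓝 0)) {v : ℝ}
    (hv : Tendsto (fun n ↦ (τ n : ℝ) * u n ^ 2) l (𝓝 v)) :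
    Tendsto (fun n ↦ charFun (P.map (X (τ n))) (u n)) l
      (𝓝 (Complex.exp ((-(iteratedDeriv 2 (kappa X P) 0 * v / 2) : ℝ)))) := by
  have : IsProbabilityMeasure (P.map (X 1)) :=
    Measure.isProbabilityMeasure_map (hX.measurable 1).aemeasurable
  set q := iteratedDeriv 2 (kappa X P) 0 with hq
  have hqP : q = ∫ ω, X 1 ω ^ 2 ∂P := iteratedDeriv_two_kappa_eq h0 hm
  have hq0 : 0 ≤ q := by rw [hqP]; positivity
  have hmP : ∫ ω, X 1 ω ∂P = 0 := by rw [← hm, kappa, deriv_cgf_zero h0]; simp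
  have hmem : MemLp id (2 : ℕ) (P.map (X 1)) := by
    simpa using memLp_id_map_of_zero_mem_interior (hX.measurable 1) h0 2
  refine hX.tendsto_charFun_of_isLittleO hu
    (g := fun x ↦ Complex.exp ((-(q * x ^ 2 / 2) : ℝ))) (r := fun x ↦ x ^ 2)
    (fun x ↦ ?_) ?_ hv ?_
  · rw [← Complex.ofReal_exp, Complex.norm_real, Real.norm_eq_abs, Real.abs_exp, Real.exp_le_one_iff]
    have := sq_nonneg x
    have : 0 ≤ q * x ^ 2 / 2 := by positivity
    linarith
  · have h1 : (fun x ↦ charFun (P.map (X 1)) x - (1 - ((q * x ^ 2 / 2 : ℝ) : ℂ)))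
        =o[𝓝 0] fun x : ℝ ↦ x ^ 2 := by
      have ht := taylor_isLittleO_univ (f := charFun (P.map (X 1))) (n := 2) (x₀ := 0)
        (contDiff_charFun hmem)
      simp only [sub_zero] at ht
      refine ht.congr_left fun x ↦ ?_
      rw [taylorWithinEval_charFun_two_zero (hX.measurable 1).aemeasurable (by simpa using hmem)]
      rw [hmP]
      simp only [Pi.pow_apply, ← hqP]
      push_cast
      ring
    -- The Gaussian `g` has the same second-order Taylor polynomial: substitute `-(q * x ^ 2 / 2)`
    -- into the first-order expansion of `exp` at `0`.
    have h2 : (fun x : ℝ ↦ Complex.exp ((-(q * x ^ 2 / 2) : ℝ)) - (1 - ((q * x ^ 2 / 2 : ℝ) : ℂ)))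
        =o[𝓝 0] fun x : ℝ ↦ x ^ 2 := by
      have hd := (Complex.hasDerivAt_exp 0).isLittleO
      have hc : Tendsto (fun x : ℝ ↦ ((-(q * x ^ 2 / 2) : ℝ) : ℂ)) (𝓝 0) (𝓝 0) := by
        have : Continuous fun x : ℝ ↦ ((-(q * x ^ 2 / 2) : ℝ) : ℂ) := by fun_prop
        simpa using this.tendsto 0
      have h3 := hd.comp_tendsto hc
      have h4 : ((fun x' : ℂ ↦ x' - 0) ∘ fun x : ℝ ↦ ((-(q * x ^ 2 / 2) : ℝ) : ℂ))
          =O[𝓝 0] fun x : ℝ ↦ x ^ 2 := by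
        refine Asymptotics.IsBigO.of_bound (q / 2) (Eventually.of_forall fun x ↦ ?_)
        simp only [Function.comp, sub_zero, Complex.norm_real, Real.norm_eq_abs, abs_neg]
        rw [abs_of_nonneg (by positivity), abs_of_nonneg (by positivity)]
        apply le_of_eq; ring
      refine (h3.trans_isBigO h4).congr_left fun x ↦ ?_
      simp
      ring
    refine (h1.sub h2).congr_left fun x ↦ by ring
  · have h1 := tendsto_floor_mul_of_tendsto_mul (by simpa using hu.pow 2) hv
    have h2 : Continuous fun x : ℝ ↦ Complex.exp ((-(q * x / 2) : ℝ)) := by fun_prop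
    refine ((h2.tendsto v).comp h1).congr fun n ↦ ?_
    rw [← Complex.exp_nat_mul]
    simp only [Function.comp]
    congr 1
    push_cast
    ring

end LevyCharFun

/-! ### Uniqueness for Laplace transforms on the negative half-line. -/

section LaplaceTransform

/-- Identity theorem: both transforms are analytic on the connected open left half-plane and agree
on real points accumulating at `-1`. -/
theorem complexMGF_eq_of_forall_nonpos_mgf_eq {μ μ' : Measure ℝ}
    (hμ : Set.Iic (0 : ℝ) ⊆ integrableExpSet id μ) (hμ' : Set.Iic (0 : ℝ) ⊆ integrableExpSet id μ')
    (h : ∀ θ ≤ 0, mgf id μ θ = mgf id μ' θ) {z : ℂ} (hz : z.re < 0) :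
    complexMGF id μ z = complexMGF id μ' z := by
  have hsub : ∀ {m : Measure ℝ}, Set.Iic (0 : ℝ) ⊆ integrableExpSet id m →
      AnalyticOnNhd ℂ (complexMGF id m) {z | z.re < 0} := by
    intro m hm w hw
    refine analyticAt_complexMGF ?_
    have := interior_mono hm
    rw [interior_Iic] at this
    exact this hw
  refine AnalyticOnNhd.eqOn_of_preconnected_of_frequently_eq (hsub hμ) (hsub hμ')
    (convex_halfSpace_re_lt 0).isPreconnected (z₀ := ((-1 : ℝ) : ℂ)) (by simp) ?_ hz
  have h_real : ∃ᶠ x : ℝ in 𝓝[≠] (-1), complexMGF id μ x = complexMGF id μ' x := by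
    refine Eventually.frequently ?_
    filter_upwards [mem_nhdsWithin_of_mem_nhds (Iio_mem_nhds (by norm_num : (-1 : ℝ) < 0))] with x hx
    rw [complexMGF_ofReal, complexMGF_ofReal, h x (le_of_lt hx)]
  have ht : Tendsto (fun x : ℝ ↦ (x : ℂ)) (𝓝[≠] (-1)) (𝓝[≠] ((-1 : ℝ) : ℂ)) := by
    refine tendsto_nhdsWithin_iff.2 ⟨?_, ?_⟩
    · exact (Complex.continuous_ofReal.tendsto _).mono_left nhdsWithin_le_nhds
    · filter_upwards [self_mem_nhdsWithin] with x hx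
      simpa only [Set.mem_compl_iff, Set.mem_singleton_iff, Complex.ofReal_inj] using hx
  exact ht.frequently h_real

/-- Two probability measures on `ℝ` with the same finite Laplace transform on `(-∞, 0]` agree. -/
theorem measure_ext_of_forall_nonpos_mgf_eq {μ μ' : Measure ℝ} [IsProbabilityMeasure μ]
    [IsProbabilityMeasure μ']
    (hμ : Set.Iic (0 : ℝ) ⊆ integrableExpSet id μ) (hμ' : Set.Iic (0 : ℝ) ⊆ integrableExpSet id μ')
    (h : ∀ θ ≤ 0, mgf id μ θ = mgf id μ' θ) : μ = μ' := by
  have hint : ∀ {m : Measure ℝ}, Set.Iic (0 : ℝ) ⊆ integrableExpSet id m →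
      Integrable (fun x ↦ Real.exp (-id x)) m := by
    intro m hm
    have : (-1 : ℝ) ∈ integrableExpSet id m := hm (by simp)
    simpa [integrableExpSet] using this
  -- The imaginary axis is only the boundary of the domain of analyticity. Tilting by `exp (-x)`
  -- moves the characteristic function to the line of real part `-1`, in the interior; the tilt is
  -- undone at the end.
  have hchar : ∀ (m : Measure ℝ) (u : ℝ), charFun (m.tilted (-id)) u =
      complexMGF id m (-1 + u * Complex.I) / (mgf id m (-1) : ℝ) := by
    intro m u
    rw [charFun_apply_real, integral_tilted, complexMGF, ← integral_div]
    congr with x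
    rw [mgf]
    simp only [Pi.neg_apply, id, Complex.real_smul, neg_mul, one_mul]
    rw [Complex.ofReal_div, div_mul_eq_mul_div, Complex.ofReal_exp, ← Complex.exp_add]
    congr 2
    push_cast
    ring
  have hi := hint hμ
  have hi' := hint hμ'
  have : IsProbabilityMeasure (μ.tilted (-id)) := isProbabilityMeasure_tilted hi
  have : IsProbabilityMeasure (μ'.tilted (-id)) := isProbabilityMeasure_tilted hi'
  have heq : μ.tilted (-id) = μ'.tilted (-id) := by
    refine Measure.ext_of_charFun (funext fun u ↦ ?_)
    rw [hchar, hchar, h (-1) (by norm_num),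
      complexMGF_eq_of_forall_nonpos_mgf_eq hμ hμ' h (by simp)]
  rw [← tilted_neg_same (μ := μ) (f := -id) hi, ← tilted_neg_same (μ := μ') (f := -id) hi', heq]

end LaplaceTransform

/-! ### Self-similarity of inverse stable subordinators. -/

section InverseSubordinator

variable {Ω : Type*} [MeasurableSpace Ω] {P : Measure Ω} {ν : ℝ} {D : ℝ≥0 → Ω → ℝ}

theorem IsStableSubordinator.Iic_subset_integrableExpSet [IsProbabilityMeasure P]
    (hD : IsStableSubordinator ν D P) (t : ℝ≥0) : Set.Iic (0 : ℝ) ⊆ integrableExpSet (D t) P := by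
  intro θ hθ
  -- A non-integrable exponential would give `mgf` the default value `0`, so positivity of the
  -- prescribed value forces integrability.
  rw [integrableExpSet, Set.mem_ofPred_eq, ← mgf_pos_iff, hD.mgf_eq t θ hθ]
  exact Real.exp_pos _

theorem integrableExpSet_id_map {Y : Ω → ℝ} (hY : Measurable Y) :
    integrableExpSet id (P.map Y) = integrableExpSet Y P := by
  ext θ
  simp only [integrableExpSet, Set.mem_ofPred_eq]
  rw [integrable_map_measure (by fun_prop) hY.aemeasurable]
  rfl

/-- Both Laplace exponents equal `t ^ ν * y * (-θ) ^ ν`. -/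
theorem IsStableSubordinator.map_mul [IsProbabilityMeasure P] (hD : IsStableSubordinator ν D P)
    {t : ℝ≥0} (y : ℝ≥0) :
    P.map (D (t ^ ν * y)) = P.map (fun ω ↦ t * D y ω) := by
  have hm1 := hD.isLevyProcess.measurable (t ^ ν * y)
  have hm2 := hD.isLevyProcess.measurable y
  have hm3 : Measurable fun ω ↦ t * D y ω := by fun_prop
  have := Measure.isProbabilityMeasure_map (μ := P) hm1.aemeasurable
  have := Measure.isProbabilityMeasure_map (μ := P) hm3.aemeasurable
  have ht : ∀ θ ≤ (0 : ℝ), (t : ℝ) * θ ≤ 0 := fun θ hθ ↦ mul_nonpos_of_nonneg_of_nonpos t.2 hθ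
  refine measure_ext_of_forall_nonpos_mgf_eq ?_ ?_ fun θ hθ ↦ ?_
  · rw [integrableExpSet_id_map hm1]
    exact hD.Iic_subset_integrableExpSet _
  · rw [integrableExpSet_id_map hm3]
    intro θ hθ
    have := hD.Iic_subset_integrableExpSet y (ht θ hθ)
    simp only [integrableExpSet, Set.mem_ofPred_eq] at this ⊢
    refine this.congr (Eventually.of_forall fun ω ↦ ?_)
    change Real.exp _ = Real.exp _
    rw [mul_left_comm, ← mul_assoc]
  · rw [mgf_id_map hm1.aemeasurable, mgf_id_map hm3.aemeasurable, hD.mgf_eq _ _ hθ]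
    have hθ' : 0 ≤ -θ := by linarith
    rw [mgf_const_mul, hD.mgf_eq _ _ (ht θ hθ), ← mul_neg, Real.mul_rpow (NNReal.coe_nonneg t) hθ']
    push_cast
    ring_nf

/-- Chernoff's bound at `θ = -1`. It ensures that the infimum defining the inverse is over a
nonempty set. -/
theorem IsStableSubordinator.ae_exists_lt [IsProbabilityMeasure P]
    (hD : IsStableSubordinator ν D P) : ∀ᵐ ω ∂P, ∀ x : ℝ, ∃ s, x < D s ω := by
  have key : ∀ N : ℕ, ∀ᵐ ω ∂P, ∃ n : ℕ, (N : ℝ) < D n ω := by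
    intro N
    rw [ae_iff]
    simp only [not_exists, not_lt]
    have hle : ∀ n : ℕ, P.real {ω | ∀ n : ℕ, D n ω ≤ N} ≤ Real.exp N * Real.exp (-n) := by
      intro n
      calc P.real {ω | ∀ n : ℕ, D n ω ≤ N} ≤ P.real {ω | D n ω ≤ N} :=
            measureReal_mono fun ω hω ↦ hω n
        _ ≤ Real.exp (-(-1) * N) * mgf (D n) P (-1) :=
            measure_le_le_exp_mul_mgf _ (by norm_num)
              (hD.Iic_subset_integrableExpSet n (by simp))
        _ = Real.exp N * Real.exp (-n) := by
            rw [hD.mgf_eq _ _ (by norm_num)]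
            simp
    have hlim : Tendsto (fun n : ℕ ↦ Real.exp N * Real.exp (-n)) atTop (𝓝 0) := by
      have := (Real.tendsto_exp_neg_atTop_nhds_zero.comp
        (tendsto_natCast_atTop_atTop (R := ℝ))).const_mul (Real.exp N)
      simpa [Function.comp_def] using this
    have h0 := ge_of_tendsto' hlim hle
    exact (measureReal_eq_zero_iff).1 (le_antisymm h0 measureReal_nonneg)
  filter_upwards [ae_all_iff.2 key] with ω hω x
  obtain ⟨N, hN⟩ := exists_nat_gt x
  obtain ⟨n, hn⟩ := hω N
  exact ⟨n, hN.trans hn⟩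

theorem tendsto_measure_Iic_add_div (μ : Measure ℝ≥0) [IsFiniteMeasure μ] (x c : ℝ≥0) :
    Tendsto (fun n : ℕ ↦ μ (Set.Iic (x + c / (n + 1)))) atTop (𝓝 (μ (Set.Iic x))) := by
  have hlim : Tendsto (fun n : ℕ ↦ x + c / ((n : ℝ≥0) + 1)) atTop (𝓝 x) := by
    have h1 : Tendsto (fun n : ℕ ↦ x + c * (1 / ((n : ℝ≥0) + 1))) atTop (𝓝 (x + c * 0)) :=
      (tendsto_one_div_add_atTop_nhds_zero_nat (𝕜 := ℝ≥0)).const_mul c |>.const_add x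
    simpa only [mul_one_div, mul_zero, add_zero] using h1
  have hI : Set.Iic x = ⋂ n : ℕ, Set.Iic (x + c / ((n : ℝ≥0) + 1)) := by
    ext y
    simp only [Set.mem_Iic, Set.mem_iInter]
    exact ⟨fun hy n ↦ hy.trans le_self_add, fun hy ↦ ge_of_tendsto' hlim hy⟩
  rw [hI]
  refine tendsto_measure_iInter_atTop (fun n ↦ measurableSet_Iic.nullMeasurableSet) ?_
    ⟨0, measure_ne_top _ _⟩
  intro n m hnm
  refine Set.Iic_subset_Iic.2 ?_
  gcongr

variable {L : ℝ≥0 → Ω → ℝ≥0}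

/-- The event `t < D y` lies almost surely between `L t < y` and `L t ≤ y`; letting `y` decrease to
`x` removes the boundary ambiguity. The step `c` is free so that it can be matched to a rescaling.
-/
theorem tendsto_measure_lt_subordinator [IsProbabilityMeasure P]
    (hD : IsStableSubordinator ν D P) (hLm : ∀ t, Measurable (L t))
    (hL : ∀ᵐ ω ∂P, ∀ t : ℝ≥0, L t ω = sInf {s : ℝ≥0 | (t : ℝ) < D s ω}) (t x : ℝ≥0) {c : ℝ≥0}
    (hc : 0 < c) :
    Tendsto (fun n : ℕ ↦ P {ω | (t : ℝ) < D (x + c / (n + 1)) ω}) atTop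
      (𝓝 (P.map (L t) (Set.Iic x))) := by
  have hmap : ∀ y, P.map (L t) (Set.Iic y) = P {ω | L t ω ≤ y} := fun y ↦ by
    rw [Measure.map_apply (hLm t) measurableSet_Iic]; rfl
  have hup : ∀ y, P {ω | (t : ℝ) < D y ω} ≤ P {ω | L t ω ≤ y} := by
    intro y
    refine measure_mono_ae ?_
    filter_upwards [hL] with ω hω hlt
    change L t ω ≤ y
    rw [hω t]
    exact csInf_le (OrderBot.bddBelow _) hlt
  have hlow : ∀ y, P {ω | L t ω < y} ≤ P {ω | (t : ℝ) < D y ω} := by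
    intro y
    refine measure_mono_ae ?_
    filter_upwards [hL, hD.ae_exists_lt, hD.monotone] with ω hω hne hmono hlt
    have hlt' : L t ω < y := hlt
    rw [hω t] at hlt'
    obtain ⟨s, hs, hsy⟩ := exists_lt_of_csInf_lt (hne t) hlt'
    exact lt_of_lt_of_le hs (hmono hsy.le)
  refine tendsto_of_tendsto_of_tendsto_of_le_of_le tendsto_const_nhds
    (tendsto_measure_Iic_add_div (P.map (L t)) x c) (fun n ↦ ?_) (fun n ↦ ?_)
  · simp only [hmap]
    refine le_trans (measure_mono fun ω hω ↦ ?_) (hlow _)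
    exact lt_of_le_of_lt hω (lt_add_of_pos_right x (by positivity))
  · simp only [hmap]
    exact hup _

/-- Self-similarity of inverse stable subordinators: `L t` has the law of `t ^ ν * L 1`. -/
theorem IsInverseStableSubordinator.identDistrib [IsProbabilityMeasure P]
    (hL : IsInverseStableSubordinator ν L P) {t : ℝ≥0} (ht : 0 < t) :
    IdentDistrib (L t) (fun ω ↦ t ^ ν * L 1 ω) P P := by
  have hLm := hL.measurable
  obtain ⟨D, hD, hLD⟩ := hL.exists_subordinator
  have hm : Measurable fun ω ↦ t ^ ν * L 1 ω := by fun_prop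
  refine ⟨(hLm t).aemeasurable, hm.aemeasurable, ?_⟩
  have := Measure.isProbabilityMeasure_map (μ := P) (hLm t).aemeasurable
  refine Measure.ext_of_Iic _ _ fun a ↦ ?_
  have hpos : 0 < t ^ ν := NNReal.rpow_pos ht
  -- The offsets `t ^ ν / (n + 1)` here and `1 / (n + 1)` below correspond under multiplication by
  -- `t ^ ν`, so the two sequences coincide term by term.
  have h1 := tendsto_measure_lt_subordinator hD hLm hLD t a hpos
  have h2 := tendsto_measure_lt_subordinator hD hLm hLD 1 (a / t ^ ν) one_pos
  have e : P.map (fun ω ↦ t ^ ν * L 1 ω) (Set.Iic a) = P.map (L 1) (Set.Iic (a / t ^ ν)) := by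
    rw [Measure.map_apply hm measurableSet_Iic, Measure.map_apply (hLm 1) measurableSet_Iic]
    congr 1
    ext ω
    simp only [Set.mem_preimage, Set.mem_Iic]
    rw [le_div_iff₀ hpos, mul_comm]
  rw [e]
  refine tendsto_nhds_unique (h1.congr fun n ↦ ?_) h2
  have e2 : a + t ^ ν / ((n : ℝ≥0) + 1) = t ^ ν * (a / t ^ ν + 1 / ((n : ℝ≥0) + 1)) := by
    field_simp
  have hDm := hD.isLevyProcess.measurable
  have e3 : P {ω | (t : ℝ) < D (a + t ^ ν / ((n : ℝ≥0) + 1)) ω} =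
      P.map (D (t ^ ν * (a / t ^ ν + 1 / ((n : ℝ≥0) + 1)))) (Set.Ioi (t : ℝ)) := by
    rw [Measure.map_apply (hDm _) measurableSet_Ioi, e2]
    rfl
  rw [e3, hD.map_mul, Measure.map_apply ((hDm _).const_mul _) measurableSet_Ioi]
  congr 1
  ext ω
  have htr : (0 : ℝ) < t := ht
  simp only [Set.mem_preimage, Set.mem_Ioi, Set.mem_ofPred_eq, NNReal.coe_one]
  constructor
  · intro hlt
    by_contra! hle
    nlinarith
  · intro hlt
    nlinarith

end InverseSubordinator

/-! ### Lévy processes evaluated at independent random times. -/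

section TimeChange

/-- The smallest multiple of `1 / (n + 1)` which is larger than `s`. -/
noncomputable def gridAbove (n : ℕ) (s : ℝ≥0) : ℝ≥0 :=
  (⌊((n : ℝ≥0) + 1) * s⌋₊ + 1) / ((n : ℝ≥0) + 1)

theorem le_gridAbove (n : ℕ) (s : ℝ≥0) : s ≤ gridAbove n s := by
  rw [gridAbove, le_div_iff₀ (by positivity), mul_comm]
  exact (Nat.lt_floor_add_one _).le

theorem gridAbove_le (n : ℕ) (s : ℝ≥0) : gridAbove n s ≤ s + 1 / ((n : ℝ≥0) + 1) := by
  have h : (0 : ℝ≥0) < (n : ℝ≥0) + 1 := by positivity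
  rw [gridAbove, div_le_iff₀ h, add_mul s, one_div_mul_cancel h.ne', mul_comm s]
  gcongr
  exact Nat.floor_le zero_le

theorem tendsto_gridAbove (s : ℝ≥0) : Tendsto (fun n ↦ gridAbove n s) atTop (𝓝 s) := by
  have h := (tendsto_one_div_add_atTop_nhds_zero_nat (𝕜 := ℝ≥0)).const_add s
  rw [add_zero] at h
  exact tendsto_of_tendsto_of_tendsto_of_le_of_le tendsto_const_nhds h
    (fun n ↦ le_gridAbove n s) (fun n ↦ gridAbove_le n s)

/-- Evaluation on the full path space need not be jointly measurable in path and time, but on a grid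
the time is indexed by `ℕ`. Right-continuity later removes the grid. -/
theorem measurable_comp_gridAbove {E : Type*} [MeasurableSpace E] (n : ℕ) :
    Measurable fun p : (ℝ≥0 → E) × ℝ≥0 ↦ p.1 (gridAbove n p.2) := by
  have h1 : Measurable fun q : (ℝ≥0 → E) × ℕ ↦ q.1 ((q.2 + 1) / ((n : ℝ≥0) + 1)) :=
    measurable_from_prod_countable_left fun k ↦
      measurable_pi_apply (((k : ℝ≥0) + 1) / ((n : ℝ≥0) + 1))
  have h2 : Measurable fun p : (ℝ≥0 → E) × ℝ≥0 ↦ (p.1, ⌊((n : ℝ≥0) + 1) * p.2⌋₊) :=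
    measurable_fst.prodMk (Nat.measurable_floor.comp (measurable_snd.const_mul _))
  exact h1.comp h2

theorem measurable_of_tendsto_right {f : ℝ≥0 → ℂ}
    (hf : ∀ (t : ℝ≥0) (s : ℕ → ℝ≥0), Tendsto s atTop (𝓝 t) → (∀ n, t ≤ s n) →
      Tendsto (fun n ↦ f (s n)) atTop (𝓝 (f t))) : Measurable f := by
  refine measurable_of_tendsto_metrizable (f := fun n s ↦ f (gridAbove n s)) (fun n ↦ ?_)
    (tendsto_pi_nhds.2 fun s ↦ hf s _ (tendsto_gridAbove s) fun n ↦ le_gridAbove n s)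
  exact (measurable_comp_gridAbove n).comp (measurable_const.prodMk measurable_id)

variable {Ω : Type*} [MeasurableSpace Ω] {P : Measure Ω}

theorem IsLevyProcess.measurable_charFun [IsProbabilityMeasure P] {X : ℝ≥0 → Ω → ℝ}
    (hX : IsLevyProcess X P) (u : ℝ) : Measurable fun s ↦ charFun (P.map (X s)) u :=
  measurable_of_tendsto_right fun _ _ hs hst ↦ hX.tendsto_charFun_of_tendsto_right u hs hst

theorem IsLevyProcess.ae_tendsto_gridAbove {X : ℝ≥0 → Ω → ℝ} (hX : IsLevyProcess X P)
    (Y : Ω → ℝ≥0) :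
    ∀ᵐ ω ∂P, Tendsto (fun n ↦ X (gridAbove n (Y ω)) ω) atTop (𝓝 (X (Y ω) ω)) := by
  filter_upwards [hX.cadlag] with ω hω
  exact ((hω (Y ω)).1.tendsto).comp (tendsto_nhdsWithin_iff.2
    ⟨tendsto_gridAbove _, Eventually.of_forall fun n ↦ le_gridAbove n _⟩)

theorem measurable_gridAbove_comp {X : ℝ≥0 → Ω → ℝ} (hX : ∀ t, Measurable (X t)) {Y : Ω → ℝ≥0}
    (hY : Measurable Y) (n : ℕ) : Measurable fun ω ↦ X (gridAbove n (Y ω)) ω :=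
  (measurable_comp_gridAbove n).comp ((measurable_pi_lambda (fun ω t ↦ X t ω) hX).prodMk hY)

theorem IsLevyProcess.aemeasurable_comp {X : ℝ≥0 → Ω → ℝ} (hX : IsLevyProcess X P)
    {Y : Ω → ℝ≥0} (hY : Measurable Y) : AEMeasurable (fun ω ↦ X (Y ω) ω) P :=
  aemeasurable_of_tendsto_metrizable_ae atTop
    (fun n ↦ (measurable_gridAbove_comp hX.measurable hY n).aemeasurable)
    (hX.ae_tendsto_gridAbove Y)

theorem norm_cexp_sum_ofReal_mul_I {ι : Type*} (s : Finset ι) (u x : ι → ℝ) :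
    ‖Complex.exp ((∑ i ∈ s, u i * x i : ℝ) * Complex.I)‖ = 1 :=
  Complex.norm_exp_ofReal_mul_I _

variable {ι : Type*} [Fintype ι] {S : ι → ℝ≥0 → Ω → ℝ}

theorem integral_cexp_gridAbove [IsProbabilityMeasure P] (hSm : ∀ i t, Measurable (S i t))
    (hSindep : iIndepFun (fun i ω t ↦ S i t ω) P)
    {Y : Ω → ι → ℝ≥0} (hY : Measurable Y) (hSY : IndepFun (fun ω i t ↦ S i t ω) Y P)
    (u : ι → ℝ) (n : ℕ) :
    ∫ ω, Complex.exp ((∑ i, u i * S i (gridAbove n (Y ω i)) ω : ℝ) * Complex.I) ∂P =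
      ∫ ω, ∏ i, charFun (P.map (S i (gridAbove n (Y ω i)))) (u i) ∂P := by
  have hSmeas : Measurable fun ω i t ↦ S i t ω :=
    measurable_pi_lambda _ fun i ↦ measurable_pi_lambda _ fun t ↦ hSm i t
  let g : (ι → ℝ≥0 → ℝ) × (ι → ℝ≥0) → ℂ := fun p ↦
    Complex.exp ((∑ i, u i * p.1 i (gridAbove n (p.2 i)) : ℝ) * Complex.I)
  have hg : Measurable g := by
    have h1 : ∀ i, Measurable fun p : (ι → ℝ≥0 → ℝ) × (ι → ℝ≥0) ↦
        p.1 i (gridAbove n (p.2 i)) := fun i ↦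
      (measurable_comp_gridAbove n).comp
        (f := fun p : (ι → ℝ≥0 → ℝ) × (ι → ℝ≥0) ↦ (p.1 i, p.2 i))
        (((measurable_pi_apply i).comp measurable_fst).prodMk
          ((measurable_pi_apply i).comp measurable_snd))
    have h2 : Measurable fun p : (ι → ℝ≥0 → ℝ) × (ι → ℝ≥0) ↦
        ∑ i, u i * p.1 i (gridAbove n (p.2 i)) :=
      Finset.measurable_sum _ fun i _ ↦ (h1 i).const_mul _
    exact Complex.measurable_exp.comp ((Complex.measurable_ofReal.comp h2).mul_const _)
  have := Measure.isProbabilityMeasure_map (μ := P) hSmeas.aemeasurable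
  have := Measure.isProbabilityMeasure_map (μ := P) hY.aemeasurable
  have hprod := (indepFun_iff_map_prod_eq_prod_map_map hSmeas.aemeasurable hY.aemeasurable).1 hSY
  have hint : Integrable g ((P.map fun ω i t ↦ S i t ω).prod (P.map Y)) :=
    Integrable.of_bound hg.aestronglyMeasurable 1
      (Eventually.of_forall fun p ↦ (norm_cexp_sum_ofReal_mul_I _ _ _).le)
  calc ∫ ω, Complex.exp ((∑ i, u i * S i (gridAbove n (Y ω i)) ω : ℝ) * Complex.I) ∂P
      = ∫ p, g p ∂(P.map fun ω ↦ ((fun i t ↦ S i t ω), Y ω)) := by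
        rw [integral_map (hSmeas.prodMk hY).aemeasurable hg.aestronglyMeasurable]
    _ = ∫ y, ∫ s, g (s, y) ∂(P.map fun ω i t ↦ S i t ω) ∂(P.map Y) := by
        -- Fubini freezes the random times; independence of the `S i` then factors the inner
        -- integral.
        rw [hprod, integral_prod_symm _ hint]
    _ = ∫ ω', ∫ s, g (s, Y ω') ∂(P.map fun ω i t ↦ S i t ω) ∂P := by
        rw [integral_map hY.aemeasurable]
        exact (hg.stronglyMeasurable.integral_prod_left').aestronglyMeasurable
    _ = _ := by
        congr with ω'
        have hgY : Measurable fun s ↦ g (s, Y ω') := hg.comp measurable_prodMk_right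
        rw [integral_map hSmeas.aemeasurable hgY.aestronglyMeasurable]
        have hind : iIndepFun (fun i ω ↦ S i (gridAbove n (Y ω' i)) ω) P :=
          hSindep.comp (fun i f ↦ f (gridAbove n (Y ω' i))) fun i ↦ measurable_pi_apply _
        have h3 := hind.integral_fun_prod_comp
          (X := fun i ω ↦ S i (gridAbove n (Y ω' i)) ω)
          (f := fun i x ↦ Complex.exp (u i * x * Complex.I)) (fun i ↦ (hSm i _).aemeasurable)
          (fun i ↦ by fun_prop)
        simp_rw [charFun_map_eq_integral (hSm _ _).aemeasurable]
        rw [← h3]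
        congr with ω
        simp only [g]
        rw [← Complex.exp_sum]
        push_cast
        rw [Finset.sum_mul]

/-- The characteristic function of the independent time change of independent Lévy processes. -/
theorem integral_cexp_time_change [IsProbabilityMeasure P] (hS : ∀ i, IsLevyProcess (S i) P)
    (hSindep : iIndepFun (fun i ω t ↦ S i t ω) P)
    {Y : Ω → ι → ℝ≥0} (hY : Measurable Y) (hSY : IndepFun (fun ω i t ↦ S i t ω) Y P)
    (u : ι → ℝ) :
    ∫ ω, Complex.exp ((∑ i, u i * S i (Y ω i) ω : ℝ) * Complex.I) ∂P =
      ∫ ω, ∏ i, charFun (P.map (S i (Y ω i))) (u i) ∂P := by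
  have hYi : ∀ i, Measurable fun ω ↦ Y ω i := fun i ↦ (measurable_pi_apply i).comp hY
  have hprob : ∀ i t, IsProbabilityMeasure (P.map (S i t)) := fun i t ↦
    Measure.isProbabilityMeasure_map ((hS i).measurable t).aemeasurable
  have h1 : Tendsto (fun n ↦
      ∫ ω, Complex.exp ((∑ i, u i * S i (gridAbove n (Y ω i)) ω : ℝ) * Complex.I) ∂P) atTop
      (𝓝 (∫ ω, Complex.exp ((∑ i, u i * S i (Y ω i) ω : ℝ) * Complex.I) ∂P)) := by
    refine tendsto_integral_of_dominated_convergence (fun _ ↦ 1) (fun n ↦ ?_)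
      (integrable_const _) (fun n ↦ ?_) ?_
    · have := fun i ↦ measurable_gridAbove_comp (hS i).measurable (hYi i) n
      have h4 : Measurable fun ω ↦ ∑ i, u i * S i (gridAbove n (Y ω i)) ω :=
        Finset.measurable_sum _ fun i _ ↦ (this i).const_mul _
      exact (Complex.measurable_exp.comp
        ((Complex.measurable_ofReal.comp h4).mul_const _)).aestronglyMeasurable
    · exact Eventually.of_forall fun ω ↦ (norm_cexp_sum_ofReal_mul_I _ _ _).le
    · filter_upwards [ae_all_iff.2 fun i ↦ (hS i).ae_tendsto_gridAbove fun ω ↦ Y ω i] with ω hω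
      have h3 : Continuous fun x : ℝ ↦ Complex.exp (x * Complex.I) := by fun_prop
      exact (h3.tendsto _).comp (tendsto_finsetSum _ fun i _ ↦ (hω i).const_mul (u i))
  have h2 : Tendsto (fun n ↦ ∫ ω, ∏ i, charFun (P.map (S i (gridAbove n (Y ω i)))) (u i) ∂P) atTop
      (𝓝 (∫ ω, ∏ i, charFun (P.map (S i (Y ω i))) (u i) ∂P)) := by
    refine tendsto_integral_of_dominated_convergence (fun _ ↦ 1) (fun n ↦ ?_)
      (integrable_const _) (fun n ↦ ?_) ?_
    · refine (Finset.measurable_prod _ fun i _ ↦ ?_).aestronglyMeasurable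
      exact (measurable_comp_gridAbove n).comp
        ((measurable_const (a := fun s ↦ charFun (P.map (S i s)) (u i))).prodMk (hYi i))
    · refine Eventually.of_forall fun ω ↦ ?_
      rw [norm_prod]
      exact Finset.prod_le_one (fun _ _ ↦ norm_nonneg _) fun _ _ ↦ norm_charFun_le_one _
    · refine Eventually.of_forall fun ω ↦ tendsto_finsetProd _ fun i _ ↦ ?_
      exact (hS i).tendsto_charFun_of_tendsto_right _ (tendsto_gridAbove _)
        fun n ↦ le_gridAbove n _
  refine tendsto_nhds_unique h1 (h2.congr fun n ↦ ?_)
  rw [integral_cexp_gridAbove (fun i ↦ (hS i).measurable) hSindep hY hSY]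

end TimeChange

/-! ### Lévy's continuity theorem on `κ → ℝ`. -/

section Levy

theorem charFun_map_toLp_eq_integral {Ω κ : Type*} [MeasurableSpace Ω] [Fintype κ] {P : Measure Ω}
    {Y : Ω → κ → ℝ} (hY : AEMeasurable (fun ω ↦ WithLp.toLp 2 (Y ω)) P)
    (u : EuclideanSpace ℝ κ) :
    charFun (P.map fun ω ↦ WithLp.toLp 2 (Y ω)) u =
      ∫ ω, Complex.exp ((∑ i, u i * Y ω i : ℝ) * Complex.I) ∂P := by
  rw [charFun_apply, integral_map hY (by fun_prop)]
  simp [PiLp.inner_apply]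

/-- Lévy's continuity theorem for random vectors in `κ → ℝ`. -/
theorem tendstoInDistribution_of_tendsto_integral_cexp {Ω Ω' ι κ : Type*} [MeasurableSpace Ω]
    [MeasurableSpace Ω'] [Fintype κ] {P : Measure Ω} [IsProbabilityMeasure P] {P' : Measure Ω'}
    [IsProbabilityMeasure P'] {l : Filter ι} [l.IsCountablyGenerated] {X : ι → Ω → κ → ℝ}
    {Z : Ω' → κ → ℝ} (hX : ∀ t, AEMeasurable (X t) P) (hZ : AEMeasurable Z P')
    (h : ∀ u : κ → ℝ, Tendsto
      (fun t ↦ ∫ ω, Complex.exp ((∑ i, u i * X t ω i : ℝ) * Complex.I) ∂P) l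
      (𝓝 (∫ ω, Complex.exp ((∑ i, u i * Z ω i : ℝ) * Complex.I) ∂P'))) :
    TendstoInDistribution X l Z (fun _ ↦ P) P' := by
  have hlp : Measurable (WithLp.toLp 2 : (κ → ℝ) → EuclideanSpace ℝ κ) := by fun_prop
  have hX' : ∀ t, AEMeasurable (fun ω ↦ WithLp.toLp 2 (X t ω)) P :=
    fun t ↦ hlp.comp_aemeasurable (hX t)
  have hZ' : AEMeasurable (fun ω ↦ WithLp.toLp 2 (Z ω)) P' := hlp.comp_aemeasurable hZ
  refine TendstoInDistribution.continuous_comp (X := fun t ω ↦ WithLp.toLp 2 (X t ω))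
    (Z := fun ω ↦ WithLp.toLp 2 (Z ω)) (PiLp.continuous_ofLp 2 fun _ : κ ↦ ℝ)
    -- The continuity theorem is applied along sequences, which suffice for a countably generated
    -- filter.
    ⟨hX', hZ', tendsto_of_seq_tendsto fun s hs ↦
      ProbabilityMeasure.tendsto_of_tendsto_charFun fun u ↦ ?_⟩
  rw [ProbabilityMeasure.coe_mk, charFun_map_toLp_eq_integral hZ']
  exact ((h u).comp hs).congr fun n ↦ (charFun_map_toLp_eq_integral (hX' (s n)) u).symm

end Levy

/-! ### Characteristic functions of Gaussian mixtures. -/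

section Gaussian

theorem integral_cexp_pi_gaussianReal {κ : Type*} [Fintype κ] (a : κ → ℝ) :
    ∫ z, Complex.exp ((∑ i, a i * z i : ℝ) * Complex.I)
      ∂(Measure.pi fun _ : κ ↦ gaussianReal 0 1) = ∏ i, Complex.exp ((-(a i ^ 2 / 2) : ℝ)) := by
  have h1 : ∀ z : κ → ℝ, Complex.exp ((∑ i, a i * z i : ℝ) * Complex.I) =
      ∏ i, Complex.exp (a i * z i * Complex.I) := by
    intro z
    rw [← Complex.exp_sum]
    push_cast
    rw [Finset.sum_mul]
  simp_rw [h1]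
  rw [integral_fintype_prod_eq_prod (f := fun i (x : ℝ) ↦ Complex.exp (a i * x * Complex.I))]
  refine Finset.prod_congr rfl fun i _ ↦ ?_
  rw [← charFun_apply_real, charFun_gaussianReal]
  congr 1
  push_cast
  simp

theorem integral_cexp_prod_pi_gaussianReal {Ω κ : Type*} [MeasurableSpace Ω] [Fintype κ]
    {P : Measure Ω} [IsProbabilityMeasure P] {a b : Ω → κ → ℝ} (ha : Measurable a)
    (hb : Measurable b) :
    ∫ p, Complex.exp ((∑ i, (a p.1 i * p.2.1 i + b p.1 i * p.2.2 i) : ℝ) * Complex.I)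
      ∂(P.prod ((Measure.pi fun _ : κ ↦ gaussianReal 0 1).prod
          (Measure.pi fun _ : κ ↦ gaussianReal 0 1))) =
      ∫ ω, ∏ i, Complex.exp ((-((a ω i ^ 2 + b ω i ^ 2) / 2) : ℝ)) ∂P := by
  rw [integral_prod]
  · congr with ω
    have h1 : ∀ q : (κ → ℝ) × (κ → ℝ),
        Complex.exp ((∑ i, (a ω i * q.1 i + b ω i * q.2 i) : ℝ) * Complex.I) =
        Complex.exp ((∑ i, a ω i * q.1 i : ℝ) * Complex.I) *
          Complex.exp ((∑ i, b ω i * q.2 i : ℝ) * Complex.I) := by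
      intro q
      rw [← Complex.exp_add, Finset.sum_add_distrib]
      push_cast
      rw [add_mul]
    simp_rw [h1]
    rw [integral_prod_mul (fun z : κ → ℝ ↦ Complex.exp ((∑ i, a ω i * z i : ℝ) * Complex.I))
      (fun z : κ → ℝ ↦ Complex.exp ((∑ i, b ω i * z i : ℝ) * Complex.I)),
      integral_cexp_pi_gaussianReal, integral_cexp_pi_gaussianReal, ← Finset.prod_mul_distrib]
    refine Finset.prod_congr rfl fun i _ ↦ ?_
    rw [← Complex.exp_add]
    congr 1
    push_cast
    ring
  · refine Integrable.of_bound ?_ 1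
      (Eventually.of_forall fun p ↦ (Complex.norm_exp_ofReal_mul_I _).le)
    have hai : ∀ i, Measurable fun ω ↦ a ω i := fun i ↦ (measurable_pi_apply i).comp ha
    have hbi : ∀ i, Measurable fun ω ↦ b ω i := fun i ↦ (measurable_pi_apply i).comp hb
    have h2 : Measurable fun p : Ω × (κ → ℝ) × (κ → ℝ) ↦
        ∑ i, (a p.1 i * p.2.1 i + b p.1 i * p.2.2 i) :=
      Finset.measurable_sum _ fun i _ ↦
        (((hai i).comp measurable_fst).mul (by fun_prop)).add
        (((hbi i).comp measurable_fst).mul (by fun_prop))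
    exact (Complex.measurable_exp.comp
      ((Complex.measurable_ofReal.comp h2).mul_const _)).aestronglyMeasurable

end Gaussian

/-! ### Limits of the rescaled clocks. -/

section Scaling

theorem tendsto_rpow_mul_rpow_neg_max (a b : ℝ) :
    Tendsto (fun t : ℝ≥0 ↦ (t : ℝ) ^ a * (t : ℝ) ^ (-(max b a))) atTop
      (𝓝 (if b ≤ a then 1 else 0)) := by
  have hcoe : Tendsto (fun t : ℝ≥0 ↦ (t : ℝ)) atTop atTop := NNReal.tendsto_coe_atTop.2 tendsto_id
  have he : (fun t : ℝ≥0 ↦ (t : ℝ) ^ (a - max b a)) =ᶠ[atTop]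
      fun t : ℝ≥0 ↦ (t : ℝ) ^ a * (t : ℝ) ^ (-(max b a)) := by
    filter_upwards [eventually_gt_atTop 0] with t ht
    rw [← Real.rpow_add (by exact_mod_cast ht), sub_eq_add_neg]
  refine Tendsto.congr' he ?_
  split_ifs with hba
  · rw [max_eq_right hba]
    simp
  · rw [max_eq_left (le_of_not_ge hba)]
    have := (tendsto_rpow_neg_atTop (y := b - a) (by linarith)).comp hcoe
    simpa [Function.comp_def] using this

theorem tendsto_time_mul_rpow_neg_max (a b : ℝ) (c c₀ x y : ℝ≥0) :
    Tendsto (fun t : ℝ≥0 ↦ ((c * (t ^ a * x) + c₀ * (t ^ b * y) : ℝ≥0) : ℝ) *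
      (t : ℝ) ^ (-(max b a))) atTop
      (𝓝 (c * x * (if b ≤ a then 1 else 0) + c₀ * y * (if a ≤ b then 1 else 0))) := by
  have h1 := (tendsto_rpow_mul_rpow_neg_max a b).const_mul ((c : ℝ) * x)
  have h2 := (tendsto_rpow_mul_rpow_neg_max b a).const_mul ((c₀ : ℝ) * y)
  refine (h1.add h2).congr fun t ↦ ?_
  rw [max_comm a b]
  push_cast
  ring

theorem tendsto_const_mul_rpow_neg {N : ℝ} (hN : 0 < N) (u : ℝ) :
    Tendsto (fun t : ℝ≥0 ↦ u * (t : ℝ) ^ (-N)) atTop (𝓝 0) := by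
  have hcoe : Tendsto (fun t : ℝ≥0 ↦ (t : ℝ)) atTop atTop := NNReal.tendsto_coe_atTop.2 tendsto_id
  simpa [Function.comp_def] using ((tendsto_rpow_neg_atTop hN).comp hcoe).const_mul u

end Scaling

/-! ### The two limit theorems. -/

section Main

variable {Ω : Type*} [MeasurableSpace Ω] {P : Measure Ω}
    {h : ℕ} {S : Fin h → ℝ≥0 → Ω → ℝ} {L : Fin (h + 1) → ℝ≥0 → Ω → ℝ≥0}
    {c : Fin (h + 1) → ℝ≥0} {ν : Fin (h + 1) → ℝ}

theorem aemeasurable_scaledProcess (hS : ∀ i, IsLevyProcess (S i) P)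
    (hL : ∀ j t, Measurable (L j t)) (t : ℝ≥0) :
    AEMeasurable (scaledProcess P S L c ν t) P := by
  refine aemeasurable_pi_lambda _ fun i ↦ ?_
  have := hL 0 t
  have := hL i.succ t
  exact (((hS i).aemeasurable_comp (by fun_prop)).div_const _).const_mul _

variable [IsProbabilityMeasure P]

/-- Independence of the clocks upgrades the one-dimensional self-similarity to a joint one. A single
time is enough, since `X(t)` involves the clocks only at `t`. -/
theorem identDistrib_inverseStable_vector
    (hL : ∀ j, IsInverseStableSubordinator (ν j) (L j) P)
    (hLindep : iIndepFun (fun j ω t ↦ L j t ω) P) {t : ℝ≥0} (ht : 0 < t) :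
    IdentDistrib (fun ω j ↦ L j t ω) (fun ω j ↦ t ^ ν j * L j 1 ω) P P :=
  IdentDistrib.pi (fun j ↦ (hL j).identDistrib ht)
    (hLindep.comp (fun _ f ↦ f t) fun _ ↦ measurable_pi_apply _)
    (hLindep.comp (fun j f ↦ t ^ ν j * f 1) fun _ ↦ (measurable_pi_apply _).const_mul _)

theorem integral_cexp_scaledProcess (hS : ∀ i, IsLevyProcess (S i) P)
    (hL : ∀ j, IsInverseStableSubordinator (ν j) (L j) P)
    (hSindep : iIndepFun (fun i ω t ↦ S i t ω) P)
    (hLindep : iIndepFun (fun j ω t ↦ L j t ω) P)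
    (hSL : IndepFun (fun ω i t ↦ S i t ω) (fun ω j t ↦ L j t ω) P) {t : ℝ≥0} (ht : 0 < t)
    (u : Fin h → ℝ) :
    ∫ ω, Complex.exp ((∑ i, u i * scaledProcess P S L c ν t ω i : ℝ) * Complex.I) ∂P =
      ∫ ω, ∏ i, charFun
        (P.map (S i (c i.succ * (t ^ ν i.succ * L i.succ 1 ω) + c 0 * (t ^ ν 0 * L 0 1 ω))))
        (u i * (t : ℝ) ^ (scalingExponent (meanVector S P) (max (ν 0) (ν i.succ)) - 1)) ∂P := by
  have htR : (0 : ℝ) < t := ht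
  let w : Fin h → ℝ := fun i ↦
    u i * (t : ℝ) ^ (scalingExponent (meanVector S P) (max (ν 0) (ν i.succ)) - 1)
  let τ : (Fin (h + 1) → ℝ≥0) → Fin h → ℝ≥0 := fun y i ↦ c i.succ * y i.succ + c 0 * y 0
  have hτ : Measurable τ := measurable_pi_lambda _ fun i ↦ by fun_prop
  have hLt : Measurable fun ω j ↦ L j t ω := measurable_pi_lambda _ fun j ↦ (hL j).measurable t
  have hind : IndepFun (fun ω i t ↦ S i t ω) (fun ω ↦ τ fun j ↦ L j t ω) P :=
    hSL.comp (φ := id) (ψ := fun f : Fin (h + 1) → ℝ≥0 → ℝ≥0 ↦ τ fun j ↦ f j t) measurable_id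
      (hτ.comp (measurable_pi_lambda (fun (f : Fin (h + 1) → ℝ≥0 → ℝ≥0) j ↦ f j t) fun j ↦
        (measurable_pi_apply t).comp (measurable_pi_apply j)))
  have h1 := integral_cexp_time_change hS hSindep (hτ.comp hLt) hind w
  let F : (Fin (h + 1) → ℝ≥0) → ℂ := fun y ↦ ∏ i, charFun (P.map (S i (τ y i))) (w i)
  have hF : Measurable F := Finset.measurable_prod _ fun i _ ↦
    ((hS i).measurable_charFun (w i)).comp ((measurable_pi_apply i).comp hτ)
  -- Once the `S i` are integrated out, only the law of the clocks matters, so they may be replaced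
  -- by scaled copies of their values at `1`; limits can then be taken for each fixed `ω`.
  have h2 := ((identDistrib_inverseStable_vector hL hLindep ht).comp hF).integral_eq
  refine Eq.trans ?_ (h1.trans h2)
  congr with ω
  congr 3
  refine Finset.sum_congr rfl fun i _ ↦ ?_
  simp only [scaledProcess, Function.comp_apply, w, τ, Real.rpow_sub_one htR.ne']
  ring

theorem tendsto_integral_cexp_scaledProcess (hS : ∀ i, IsLevyProcess (S i) P)
    (hL : ∀ j, IsInverseStableSubordinator (ν j) (L j) P)
    (hSindep : iIndepFun (fun i ω t ↦ S i t ω) P)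
    (hLindep : iIndepFun (fun j ω t ↦ L j t ω) P)
    (hSL : IndepFun (fun ω i t ↦ S i t ω) (fun ω j t ↦ L j t ω) P)
    (u : Fin h → ℝ) {G : Fin h → Ω → ℂ}
    (hG : ∀ i ω, Tendsto (fun t : ℝ≥0 ↦ charFun
        (P.map (S i (c i.succ * (t ^ ν i.succ * L i.succ 1 ω) + c 0 * (t ^ ν 0 * L 0 1 ω))))
        (u i * (t : ℝ) ^ (scalingExponent (meanVector S P) (max (ν 0) (ν i.succ)) - 1)))
        atTop (𝓝 (G i ω))) :
    Tendsto (fun t ↦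
      ∫ ω, Complex.exp ((∑ i, u i * scaledProcess P S L c ν t ω i : ℝ) * Complex.I) ∂P) atTop
      (𝓝 (∫ ω, ∏ i, G i ω ∂P)) := by
  have hLm := fun j ↦ (hL j).measurable 1
  have hprob : ∀ i t, IsProbabilityMeasure (P.map (S i t)) := fun i t ↦
    Measure.isProbabilityMeasure_map ((hS i).measurable t).aemeasurable
  refine Tendsto.congr' (f₁ := fun t : ℝ≥0 ↦ ∫ ω, ∏ i, charFun
        (P.map (S i (c i.succ * (t ^ ν i.succ * L i.succ 1 ω) + c 0 * (t ^ ν 0 * L 0 1 ω))))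
        (u i * (t : ℝ) ^ (scalingExponent (meanVector S P) (max (ν 0) (ν i.succ)) - 1)) ∂P) ?_ ?_
  · filter_upwards [eventually_gt_atTop 0] with t ht
    rw [integral_cexp_scaledProcess hS hL hSindep hLindep hSL ht]
  refine tendsto_integral_filter_of_dominated_convergence (fun _ ↦ 1)
    (Eventually.of_forall fun t ↦ ?_) (Eventually.of_forall fun t ↦ ?_) (integrable_const _) ?_
  · refine (Finset.measurable_prod _ fun i _ ↦ ?_).aestronglyMeasurable
    have h0 := hLm 0
    have h1 := hLm i.succ
    exact ((hS i).measurable_charFun _).comp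
      (g := fun s ↦ charFun (P.map (S i s)) _) (by fun_prop)
  · refine Eventually.of_forall fun ω ↦ ?_
    rw [norm_prod]
    exact Finset.prod_le_one (fun _ _ ↦ norm_nonneg _) fun _ _ ↦ norm_charFun_le_one _
  · exact Eventually.of_forall fun ω ↦ tendsto_finsetProd _ fun i _ ↦ hG i ω

theorem tendstoInDistribution_scaledProcess_of_mean_eq_zero
    (hν : ∀ j, ν j ∈ Set.Ioo (0 : ℝ) 1)
    (hS : ∀ i, IsLevyProcess (S i) P)
    (hSlight : ∀ i, (0 : ℝ) ∈ interior (integrableExpSet (S i 1) P))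
    (hL : ∀ j, IsInverseStableSubordinator (ν j) (L j) P)
    (hSindep : iIndepFun (fun i ω t ↦ S i t ω) P)
    (hLindep : iIndepFun (fun j ω t ↦ L j t ω) P)
    (hSL : IndepFun (fun ω i t ↦ S i t ω) (fun ω j t ↦ L j t ω) P)
    (hm : meanVector S P = 0) :
    TendstoInDistribution (scaledProcess P S L c ν) atTop
      (fun (p : Ω × (Fin h → ℝ) × (Fin h → ℝ)) (i : Fin h) ↦
        √((c i.succ : ℝ) * (L i.succ 1 p.1 : ℝ) * iteratedDeriv 2 (kappa (S i) P) 0 *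
            (if ν 0 ≤ ν i.succ then 1 else 0)) * p.2.1 i +
        √((c 0 : ℝ) * (L 0 1 p.1 : ℝ) * iteratedDeriv 2 (kappa (S i) P) 0 *
            (if ν i.succ ≤ ν 0 then 1 else 0)) * p.2.2 i)
      (fun _ ↦ P)
      (P.prod ((Measure.pi fun _ : Fin h ↦ gaussianReal 0 1).prod
        (Measure.pi fun _ : Fin h ↦ gaussianReal 0 1))) := by
  have hLm := fun j ↦ (hL j).measurable 1
  have hmi : ∀ i, deriv (kappa (S i) P) 0 = 0 := fun i ↦ congrFun hm i
  let a : Ω → Fin h → ℝ := fun ω i ↦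
    √((c i.succ : ℝ) * (L i.succ 1 ω : ℝ) * iteratedDeriv 2 (kappa (S i) P) 0 *
      (if ν 0 ≤ ν i.succ then 1 else 0))
  let b : Ω → Fin h → ℝ := fun ω i ↦
    √((c 0 : ℝ) * (L 0 1 ω : ℝ) * iteratedDeriv 2 (kappa (S i) P) 0 *
      (if ν i.succ ≤ ν 0 then 1 else 0))
  have ha : ∀ i, Measurable fun ω ↦ a ω i := fun i ↦ by
    have := hLm i.succ
    fun_prop
  have hb : ∀ i, Measurable fun ω ↦ b ω i := fun i ↦ by
    have := hLm 0
    fun_prop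
  refine tendstoInDistribution_of_tendsto_integral_cexp
    (aemeasurable_scaledProcess hS fun j t ↦ (hL j).measurable t) ?_ fun u ↦ ?_
  · refine (measurable_pi_lambda _ fun i ↦ ?_).aemeasurable
    exact (((ha i).comp measurable_fst).mul (by fun_prop)).add
      (((hb i).comp measurable_fst).mul (by fun_prop))
  have hlim := integral_cexp_prod_pi_gaussianReal (P := P)
    (a := fun ω i ↦ u i * a ω i) (b := fun ω i ↦ u i * b ω i)
    (measurable_pi_lambda _ fun i ↦ (ha i).const_mul _)
    (measurable_pi_lambda _ fun i ↦ (hb i).const_mul _)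
  have hlim2 := tendsto_integral_cexp_scaledProcess (c := c) hS hL hSindep hLindep hSL u
    (G := fun i ω ↦ Complex.exp ((-(iteratedDeriv 2 (kappa (S i) P) 0 *
      (u i ^ 2 * (c i.succ * L i.succ 1 ω * (if ν 0 ≤ ν i.succ then 1 else 0) +
        c 0 * L 0 1 ω * (if ν i.succ ≤ ν 0 then 1 else 0))) / 2) : ℝ)))
    fun i ω ↦ by
      have hN : 0 < max (ν 0) (ν i.succ) := lt_max_of_lt_left (hν 0).1
      have hexp : scalingExponent (meanVector S P) (max (ν 0) (ν i.succ)) - 1 =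
          -(max (ν 0) (ν i.succ) / 2) := by
        rw [scalingExponent, if_pos hm]
        ring
      rw [hexp]
      refine (hS i).tendsto_charFun_exp_variance (hSlight i) (hmi i)
        (tendsto_const_mul_rpow_neg (half_pos hN) _) ?_
      refine ((tendsto_time_mul_rpow_neg_max (ν i.succ) (ν 0) (c i.succ) (c 0) (L i.succ 1 ω)
        (L 0 1 ω)).const_mul (u i ^ 2)).congr fun t ↦ ?_
      have hsq : (t : ℝ) ^ (-(max (ν 0) (ν i.succ))) =
          ((t : ℝ) ^ (-(max (ν 0) (ν i.succ) / 2))) ^ 2 := by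
        rw [← Real.rpow_mul_natCast (NNReal.coe_nonneg t)]
        congr 1
        push_cast
        ring
      rw [hsq]
      ring
  convert hlim2 using 2
  refine Eq.trans ?_ (hlim.trans ?_)
  · congr with p
    congr 3
    refine Finset.sum_congr rfl fun i _ ↦ ?_
    simp only [a, b]
    ring
  · congr with ω
    refine Finset.prod_congr rfl fun i _ ↦ ?_
    -- With zero mean this derivative is a second moment; nonnegativity is needed to square the
    -- square roots.
    have hq : 0 ≤ iteratedDeriv 2 (kappa (S i) P) 0 := by
      rw [iteratedDeriv_two_kappa_eq (hSlight i) (hmi i)]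
      positivity
    have h1 : a ω i ^ 2 = _ := Real.sq_sqrt (by positivity)
    have h2 : b ω i ^ 2 = _ := Real.sq_sqrt (by positivity)
    rw [mul_pow, mul_pow, h1, h2]
    congr 2
    ring

theorem tendstoInDistribution_scaledProcess_of_mean_ne_zero
    (hν : ∀ j, ν j ∈ Set.Ioo (0 : ℝ) 1)
    (hS : ∀ i, IsLevyProcess (S i) P)
    (hSlight : ∀ i, (0 : ℝ) ∈ interior (integrableExpSet (S i 1) P))
    (hL : ∀ j, IsInverseStableSubordinator (ν j) (L j) P)
    (hSindep : iIndepFun (fun i ω t ↦ S i t ω) P)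
    (hLindep : iIndepFun (fun j ω t ↦ L j t ω) P)
    (hSL : IndepFun (fun ω i t ↦ S i t ω) (fun ω j t ↦ L j t ω) P)
    (hm : meanVector S P ≠ 0) :
    TendstoInDistribution (scaledProcess P S L c ν) atTop
      (fun (ω : Ω) (i : Fin h) ↦
        (c i.succ : ℝ) * meanVector S P i * (if ν 0 ≤ ν i.succ then 1 else 0) *
            (L i.succ 1 ω : ℝ) +
        (c 0 : ℝ) * meanVector S P i * (if ν i.succ ≤ ν 0 then 1 else 0) * (L 0 1 ω : ℝ))
      (fun _ ↦ P) P := by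
  have hLm := fun j ↦ (hL j).measurable 1
  refine tendstoInDistribution_of_tendsto_integral_cexp
    (aemeasurable_scaledProcess hS fun j t ↦ (hL j).measurable t) ?_ fun u ↦ ?_
  · refine (measurable_pi_lambda _ fun i ↦ ?_).aemeasurable
    have := hLm 0
    have := hLm i.succ
    fun_prop
  have hlim := tendsto_integral_cexp_scaledProcess (c := c) hS hL hSindep hLindep hSL u
    (G := fun i ω ↦ Complex.exp ((deriv (kappa (S i) P) 0 *
      (u i * (c i.succ * L i.succ 1 ω * (if ν 0 ≤ ν i.succ then 1 else 0) +
        c 0 * L 0 1 ω * (if ν i.succ ≤ ν 0 then 1 else 0))) : ℝ) * Complex.I))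
    fun i ω ↦ by
      have hN : 0 < max (ν 0) (ν i.succ) := lt_max_of_lt_left (hν 0).1
      have hexp : scalingExponent (meanVector S P) (max (ν 0) (ν i.succ)) - 1 =
          -(max (ν 0) (ν i.succ)) := by
        rw [scalingExponent, if_neg hm]
        ring
      rw [hexp]
      refine (hS i).tendsto_charFun_exp_mean (hSlight i) (tendsto_const_mul_rpow_neg hN _) ?_
      refine ((tendsto_time_mul_rpow_neg_max (ν i.succ) (ν 0) (c i.succ) (c 0) (L i.succ 1 ω)
        (L 0 1 ω)).const_mul (u i)).congr fun t ↦ ?_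
      ring
  -- Given the clocks the limit is deterministic, so the product of limiting exponentials is already
  -- the integrand of its characteristic function.
  convert hlim using 3
  funext ω
  rw [← Complex.exp_sum, ← Finset.sum_mul]
  congr 2
  push_cast
  refine Finset.sum_congr rfl fun i _ ↦ ?_
  rw [meanVector]
  ring

end Main

/-- In the case `m = 0` the limit lives on `Ω × ℝ^h × ℝ^h` with the product of `P` and standard
Gaussian measures, so that the coordinates `Z_i = p.2.1 i` and `Ẑ_i = p.2.2 i` are independent
standard normal variables which are independent of everything on `Ω`. -/
theorem mainTheorem3 {Ω : Type*} [MeasurableSpace Ω] (P : Measure Ω) [IsProbabilityMeasure P]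
    (h : ℕ) (S : Fin h → ℝ≥0 → Ω → ℝ) (L : Fin (h + 1) → ℝ≥0 → Ω → ℝ≥0)
    (c : Fin (h + 1) → ℝ≥0) (ν : Fin (h + 1) → ℝ)
    (hc : ∀ j, 0 < c j) (hν : ∀ j, ν j ∈ Set.Ioo (0 : ℝ) 1)
    (hS : ∀ i, IsLevyProcess (S i) P)
    (hSlight : ∀ i, (0 : ℝ) ∈ interior (integrableExpSet (S i 1) P))
    (hL : ∀ j, IsInverseStableSubordinator (ν j) (L j) P)
    -- the `2 h + 1` processes `S_1, …, S_h, L_0, …, L_h` are independent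
    (hSindep : iIndepFun (fun i ω t ↦ S i t ω) P)
    (hLindep : iIndepFun (fun j ω t ↦ L j t ω) P)
    (hSL : IndepFun (fun ω i t ↦ S i t ω) (fun ω j t ↦ L j t ω) P) :
    (meanVector S P = 0 →
      TendstoInDistribution (scaledProcess P S L c ν) atTop
        (fun (p : Ω × (Fin h → ℝ) × (Fin h → ℝ)) (i : Fin h) ↦
          √((c i.succ : ℝ) * (L i.succ 1 p.1 : ℝ) * iteratedDeriv 2 (kappa (S i) P) 0 *
              (if ν 0 ≤ ν i.succ then 1 else 0)) * p.2.1 i +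
          √((c 0 : ℝ) * (L 0 1 p.1 : ℝ) * iteratedDeriv 2 (kappa (S i) P) 0 *
              (if ν i.succ ≤ ν 0 then 1 else 0)) * p.2.2 i)
        (fun _ ↦ P)
        (P.prod ((Measure.pi fun _ : Fin h ↦ gaussianReal 0 1).prod
          (Measure.pi fun _ : Fin h ↦ gaussianReal 0 1)))) ∧
    (meanVector S P ≠ 0 →
      TendstoInDistribution (scaledProcess P S L c ν) atTop
        (fun (ω : Ω) (i : Fin h) ↦
          (c i.succ : ℝ) * meanVector S P i * (if ν 0 ≤ ν i.succ then 1 else 0) *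
              (L i.succ 1 ω : ℝ) +
          (c 0 : ℝ) * meanVector S P i * (if ν i.succ ≤ ν 0 then 1 else 0) * (L 0 1 ω : ℝ))
        (fun _ ↦ P) P) :=
  ⟨tendstoInDistribution_scaledProcess_of_mean_eq_zero hν hS hSlight hL hSindep hLindep hSL,
    tendstoInDistribution_scaledProcess_of_mean_ne_zero hν hS hSlight hL hSindep hLindep hSL⟩
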